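/- Let $N\ge 1$ be an integer, let $L_N$ be the Legendre polynomial of degree $N$ on $(-1,1)$, and let $-1=x_0<x_1<\dots<x_N=1$ be the Legendre–Gauss–Lobatto nodes, i.e. the roots of $(1-x^2)L_N'(x)$. Let $\Psi_i$ be the polynomial of degree at most $N$ with $\Psi_i(x_j)=\delta_{ij}$ for $0\le i,j\le N$, and let $\omega_i=\int_{-1}^1\Psi_i\,dx$ be the corresponding quadrature weights. Let $\mathbb P_N$ be the space of real polynomials of degree at most $N$ and $\mathbb P_N^{Di}=\{p\in\mathbb P_N: p(-1)=p(1)=0\}$. Let $h^L,h^R\in\mathbb P_N^{Di}$ be the polynomials with $h^L(x_i)=\frac{1-x_i}{2}$ and $h^R(x_i)=\frac{1+x_i}{2}$ for $1\le i\le N-1$, and put $$G_L^N=\frac{h^L_{xx}}{\sqrt{\omega_0}}-\frac{\Psi_{0,x}}{\sqrt{\omega_0}\,\omega_0},\qquad G_R^N=\frac{h^R_{xx}}{\sqrt{\omega_N}}+\frac{\Psi_{N,x}}{\sqrt{\omega_N}\,\omega_N}.$$ Let $T>4(2+N^{-1})$ and $(u^{0,N},u^{1,N})\in\mathbb P_N^{Di}\times\mathbb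 P_N^{Di}$. Then there exist controls $f^N,g_L^N,g_R^N\in L^2(0,T)$ such that the system $$\begin{cases}(u^N_{tt}-u^N_{xx})(t,x_i)=g_L^N(t)\,G_L^N(x_i)+g_R^N(t)\,G_R^N(x_i), & t\in(0,T),\ 1\le i\le N-1,\\ u^N(t,1)=f^N(t),\quad u^N(t,-1)=0, & t\in(0,T),\\ u^N(0,x_i)=u^{0,N}(x_i),\quad u^N_t(0,x_i)=u^{1,N}(x_i), & 1\le i\le N-1,\end{cases}$$ has a solution $u^N\in C^\infty([0,T];\mathbb P_N)$, and every solution satisfies $$u^N(T,x_i)=u^N_t(T,x_i)=0,\qquad 1\le i\le N-1.$$ Here a solution is a function $u^N:[0,T]\to\mathbb P_N$ whose values at the interior nodes are $C^1$ on $[0,T]$ with absolutely continuous time derivative, which satisfies the differential equations and the boundary conditions for almost every $t\in(0,T)$, and which satisfies the initial conditions. -/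

import Mathlib

open Polynomial MeasureTheory Set
open scoped ContDiff

noncomputable section

namespace LGL

/-- The Legendre polynomial of degree `N` on `(-1, 1)` (Rodrigues' formula). -/
def legendre (N : ℕ) : ℝ[X] :=
  C (1 / (2 ^ N * (N.factorial : ℝ))) * derivative^[N] ((X ^ 2 - 1) ^ N)

/-- The Legendre-Gauss-Lobatto nodes: the roots of `(1 - x ^ 2) * L_N'`. -/
def nodes (N : ℕ) : Finset ℝ :=
  ((1 - X ^ 2) * derivative (legendre N)).roots.toFinset

/-- The collocation nodes lying in the open interval `(-1, 1)`. -/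
def interiorNodes (N : ℕ) : Finset ℝ :=
  (nodes N).filter fun x => x ∈ Ioo (-1 : ℝ) 1

/-- The Lagrange polynomial equal to `1` at the node `x` and to `0` at all the other nodes. -/
def cardinal (N : ℕ) (x : ℝ) : ℝ[X] :=
  Lagrange.basis (nodes N) id x

/-- The weight of the LGL quadrature formula at the node `x` (interpolatory quadrature). -/
def weight (N : ℕ) (x : ℝ) : ℝ :=
  ∫ y in (-1 : ℝ)..1, (cardinal N x).eval y

/-- Polynomials of degree at most `N` that vanish at `-1` and at `1`. -/
def polyDirichlet (N : ℕ) : Submodule ℝ ℝ[X] :=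
  degreeLE ℝ N ⊓ LinearMap.ker (leval (-1 : ℝ)) ⊓ LinearMap.ker (leval (1 : ℝ))

/-- The polynomial of degree at most `N` with value `(1 - x) / 2` at each interior node `x` and
value `0` at `-1` and `1`. -/
def hL (N : ℕ) : ℝ[X] :=
  ∑ x ∈ interiorNodes N, C ((1 - x) / 2) * cardinal N x

/-- The polynomial of degree at most `N` with value `(1 + x) / 2` at each interior node `x` and
value `0` at `-1` and `1`. -/
def hR (N : ℕ) : ℝ[X] :=
  ∑ x ∈ interiorNodes N, C ((1 + x) / 2) * cardinal N x

/-- The left forcing profile; the leftmost node is `-1`. -/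
def profileL (N : ℕ) : ℝ[X] :=
  C (1 / √(weight N (-1))) * derivative (derivative (hL N))
    - C (1 / (√(weight N (-1)) * weight N (-1))) * derivative (cardinal N (-1))

/-- The right forcing profile; the rightmost node is `1`. -/
def profileR (N : ℕ) : ℝ[X] :=
  C (1 / √(weight N 1)) * derivative (derivative (hR N))
    + C (1 / (√(weight N 1) * weight N 1)) * derivative (cardinal N 1)

/-- The time derivative on `[0, T]` (one-sided at the end points) of `t ↦ u(t, x)`. -/
def velocity (T : ℝ) (u : ℝ → ℝ[X]) (x t : ℝ) : ℝ :=
  derivWithin (fun s => (u s).eval x) (Icc 0 T) t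

/-- `u : [0, T] → P_N` is the solution, for square integrable controls `f`, `gL`, `gR`, of the
collocation system with initial data `u0`, `u1`. The values at the interior nodes are `C¹` on
`[0, T]` with an absolutely continuous time derivative, so that initial and final values make
sense; the equations, whose right-hand sides are only `L²` functions of time, hold at almost
every time. -/
structure IsSolution (N : ℕ) (T : ℝ) (u0 u1 : ℝ[X]) (f gL gR : ℝ → ℝ) (u : ℝ → ℝ[X]) :
    Prop where
  degree_le : ∀ t ∈ Icc 0 T, u t ∈ degreeLE ℝ N
  contDiffOn : ∀ x ∈ interiorNodes N, ContDiffOn ℝ 1 (fun t => (u t).eval x) (Icc 0 T)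
  absolutelyContinuous :
    ∀ x ∈ interiorNodes N, AbsolutelyContinuousOnInterval (velocity T u x) 0 T
  wave : ∀ x ∈ interiorNodes N, ∀ᵐ t ∂(volume.restrict (Ioo 0 T)),
    HasDerivAt (velocity T u x)
      ((derivative (derivative (u t))).eval x
        + gL t * (profileL N).eval x + gR t * (profileR N).eval x) t
  boundary_right : ∀ᵐ t ∂(volume.restrict (Ioo 0 T)), (u t).eval 1 = f t
  boundary_left : ∀ᵐ t ∂(volume.restrict (Ioo 0 T)), (u t).eval (-1) = 0
  initial_position : ∀ x ∈ interiorNodes N, (u 0).eval x = u0.eval x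
  initial_velocity : ∀ x ∈ interiorNodes N, velocity T u x 0 = u1.eval x

end LGL

end

/-!
The interior values `y` of a solution satisfy a linear system `y'' = A y + B c` of ordinary
differential equations, where `A` is the collocation second derivative with homogeneous Dirichlet
conditions and the three components of `c` are `f`, `g_L`, `g_R`; the control `f` acts through
`f Ψ_N''`, and a solution is recovered from `y` by adding `f Ψ_N`. The proof is Kalman's
controllability theorem for this system, in any positive time (`exists_null_control`), together
with uniqueness of its solutions (`IsSolution.unique`).

The Kalman condition is an observability statement, `collocation_observable`. Gauss–Lobatto
quadrature is exact up to degree `2N - 1` (`integral_eq_sum_nodes`) and has positive weights, so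
that `A` is symmetric for the discrete inner product, and discrete integrations by parts are exact.
They give, for a polynomial `φ` of degree at most `N` vanishing at both ends,
`⟨G_L, φ⟩ = -√ω₀ φ''(-1)` and `⟨G_R, φ⟩ = -√ω_N φ''(1)` (`sum_profileL`, `sum_profileR`): the two
parts of a profile are balanced so that `φ'` cancels. If both observations vanish along the
dynamics of `A`, then the interpolant of `A φ` is exactly `φ''`, and likewise for all the iterates.
Thus `φ` is annihilated by a power of the second derivative, each iterate vanishing at both ends;
since a polynomial with zero second derivative and zero end values is zero, `φ = 0`.

The facts on nodes rest on Rolle's theorem, which counts the roots of the derivatives of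
`(x ^ 2 - 1) ^ N`, and on the Gauss–Lucas theorem, which locates them in `(-1, 1)`.
-/

noncomputable section

namespace LGL

/-! ### The Lobatto nodes -/

theorem eval_iterate_derivative_eq_zero {N k : ℕ} (hk : k < N) {e : ℝ} (he : e ^ 2 = 1) :
    (derivative^[k] ((X ^ 2 - 1 : ℝ[X]) ^ N)).eval e = 0 := by
  obtain ⟨q, hq⟩ := pow_sub_dvd_iterate_derivative_pow (X ^ 2 - 1 : ℝ[X]) N k
  rw [hq]
  simp [he, Nat.sub_ne_zero_of_lt hk]

theorem natDegree_iterate_derivative_le (N k : ℕ) :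
    (derivative^[k] ((X ^ 2 - 1 : ℝ[X]) ^ N)).natDegree ≤ 2 * N - k := by
  refine (natDegree_iterate_derivative _ _).trans ?_
  gcongr
  have h : (X ^ 2 - 1 : ℝ[X]).natDegree ≤ 2 := by compute_degree
  calc _ ≤ N * (X ^ 2 - 1 : ℝ[X]).natDegree := natDegree_pow_le
    _ ≤ N * 2 := by gcongr
    _ = _ := by ring

/-- Rolle's theorem produces one new interior root at each differentiation, and the end points
remain roots as long as `k < N`. -/
theorem add_two_le_card_roots {N k : ℕ} (hk : k < N) :
    k + 2 ≤ (derivative^[k] ((X ^ 2 - 1 : ℝ[X]) ^ N)).roots.toFinset.card := by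
  induction k with
  | zero =>
    have h0 : ((X ^ 2 - 1 : ℝ[X]) ^ N) ≠ 0 :=
      pow_ne_zero _ (X_pow_sub_C_ne_zero (R := ℝ) two_pos 1)
    have hsub : ({-1, 1} : Finset ℝ) ⊆ ((X ^ 2 - 1 : ℝ[X]) ^ N).roots.toFinset := by
      intro x hx
      have hx2 : x ^ 2 = 1 := by
        rcases Finset.mem_insert.1 hx with rfl | hx
        · norm_num
        · rw [Finset.mem_singleton.1 hx]; norm_num
      rw [Multiset.mem_toFinset, mem_roots h0]
      exact eval_iterate_derivative_eq_zero hk hx2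
    refine le_trans ?_ (Finset.card_le_card hsub)
    rw [Finset.card_pair (by norm_num)]
  | succ k ih =>
    have ih := ih (by omega)
    rw [Function.iterate_succ_apply']
    set P := derivative^[k] ((X ^ 2 - 1 : ℝ[X]) ^ N) with hP
    have hR := card_roots_toFinset_le_card_roots_derivative_sdiff_roots_succ P
    have hP0 : P ≠ 0 := by rintro h; rw [h] at ih; simp at ih
    have hP1 : derivative P ≠ 0 := by rintro h; rw [h] at hR; simp at hR; omega
    have hroot : ∀ e : ℝ, e ^ 2 = 1 → e ∈ P.roots.toFinset ∧ e ∈ (derivative P).roots.toFinset := by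
      intro e he
      have h1 := eval_iterate_derivative_eq_zero (N := N) (k := k) (by omega) he
      have h2 := eval_iterate_derivative_eq_zero hk he
      rw [Function.iterate_succ_apply'] at h2
      simpa [hP0, hP1] using And.intro h1 h2
    have hsub : ({-1, 1} : Finset ℝ) ∪ ((derivative P).roots.toFinset \ P.roots.toFinset) ⊆
        (derivative P).roots.toFinset := by
      refine Finset.union_subset ?_ Finset.sdiff_subset
      intro x hx
      refine (hroot x ?_).2
      rcases Finset.mem_insert.1 hx with rfl | hx
      · norm_num
      · rw [Finset.mem_singleton.1 hx]; norm_num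
    have hdisj : Disjoint ({-1, 1} : Finset ℝ)
        ((derivative P).roots.toFinset \ P.roots.toFinset) := by
      rw [Finset.disjoint_left]
      intro x hx hx'
      refine (Finset.mem_sdiff.1 hx').2 (hroot x ?_).1
      rcases Finset.mem_insert.1 hx with rfl | hx
      · norm_num
      · rw [Finset.mem_singleton.1 hx]; norm_num
    have := Finset.card_le_card hsub
    rw [Finset.card_union_of_disjoint hdisj, Finset.card_pair (by norm_num)] at this
    omega

theorem legendre_eq (N : ℕ) : ∃ c : ℝ, c ≠ 0 ∧
    legendre N = C c * derivative^[N] ((X ^ 2 - 1) ^ N) :=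
  ⟨_, by positivity, rfl⟩

theorem natDegree_legendre_le (N : ℕ) : (legendre N).natDegree ≤ N := by
  obtain ⟨c, -, h⟩ := legendre_eq N
  rw [h]
  exact (natDegree_C_mul_le _ _).trans ((natDegree_iterate_derivative_le N N).trans (by omega))

/-- All the roots of `L_N` come from Rolle's theorem, hence none of them is an end point. -/
theorem legendre_roots {N : ℕ} (hN : 1 ≤ N) :
    N ≤ (legendre N).roots.toFinset.card ∧ (legendre N).eval (-1) ≠ 0 ∧
      (legendre N).eval 1 ≠ 0 := by
  obtain ⟨c, hc, hL⟩ := legendre_eq N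
  have hroots : (legendre N).roots = (derivative^[N] ((X ^ 2 - 1 : ℝ[X]) ^ N)).roots := by
    rw [hL, roots_C_mul _ hc]
  obtain ⟨M, rfl⟩ : ∃ M, N = M + 1 := ⟨N - 1, by omega⟩
  rw [Function.iterate_succ_apply'] at hroots
  have hcard := add_two_le_card_roots (N := M + 1) (k := M) (by omega)
  set P := derivative^[M] ((X ^ 2 - 1 : ℝ[X]) ^ (M + 1)) with hP
  have hR := card_roots_toFinset_le_card_roots_derivative_sdiff_roots_succ P
  have hP0 : P ≠ 0 := by rintro h; rw [h] at hcard; simp at hcard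
  rw [← hroots] at hR
  have hL0 : legendre (M + 1) ≠ 0 := by rintro h; rw [h] at hR; simp at hR; omega
  have hle : (legendre (M + 1)).roots.toFinset.card ≤ M + 1 :=
    (Multiset.toFinset_card_le _).trans ((card_roots' _).trans (natDegree_legendre_le _))
  -- The Rolle roots exhaust the degree, and the end points, being roots of `P`, are not among them.
  have heq : (legendre (M + 1)).roots.toFinset \ P.roots.toFinset
      = (legendre (M + 1)).roots.toFinset :=
    Finset.eq_of_subset_of_card_le Finset.sdiff_subset (by omega)
  have hne : ∀ e : ℝ, e ^ 2 = 1 → (legendre (M + 1)).eval e ≠ 0 := by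
    intro e he h
    have h1 : e ∈ (legendre (M + 1)).roots.toFinset := by simpa [hL0] using h
    rw [← heq, Finset.mem_sdiff] at h1
    refine h1.2 ?_
    have := eval_iterate_derivative_eq_zero (N := M + 1) (k := M) (by omega) he
    simpa [hP0] using this
  rw [heq] at hR
  exact ⟨by omega, hne _ (by norm_num), hne _ (by norm_num)⟩

/-- Gauss–Lucas theorem for real polynomials: if all the complex roots lie in a convex set, so do
the complex roots of the derivative. -/
theorem complex_roots_derivative {p : ℝ[X]} (hp : derivative p ≠ 0) {S : Set ℂ}
    (hS : Convex ℝ S) (h : ∀ z : ℂ, aeval z p = 0 → z ∈ S) :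
    ∀ z : ℂ, aeval z (derivative p) = 0 → z ∈ S := by
  intro z hz
  have hdeg : 0 < (p.map (algebraMap ℝ ℂ)).degree := by
    rw [degree_map, ← natDegree_pos_iff_degree_pos]
    by_contra hcon
    exact hp (derivative_of_natDegree_zero (by omega))
  have hsub : (p.map (algebraMap ℝ ℂ)).rootSet ℂ ⊆ S := by
    intro w hw
    have := aeval_eq_zero_of_mem_rootSet hw
    rw [aeval_map_algebraMap] at this
    exact h w this
  refine convexHull_min hsub hS (rootSet_derivative_subset_convexHull_rootSet hdeg ?_)
  rw [mem_rootSet, derivative_map]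
  refine ⟨?_, by rwa [aeval_map_algebraMap]⟩
  rwa [Ne, Polynomial.map_eq_zero]

theorem complex_roots_iterate_derivative (N : ℕ) {k : ℕ}
    (h0 : derivative^[k] ((X ^ 2 - 1 : ℝ[X]) ^ N) ≠ 0) :
    ∀ z : ℂ, aeval z (derivative^[k] ((X ^ 2 - 1 : ℝ[X]) ^ N)) = 0 →
      z.im = 0 ∧ z.re ∈ Icc (-1 : ℝ) 1 := by
  induction k with
  | zero =>
    intro z hz
    have hz' : (z ^ 2 - 1) ^ N = 0 := by simpa using hz
    have h2 : (z - 1) * (z + 1) = 0 := by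
      rw [← eq_zero_of_pow_eq_zero hz']; ring
    rcases mul_eq_zero.1 h2 with h | h
    · rw [sub_eq_zero.1 h]; simp
    · rw [eq_neg_of_add_eq_zero_left h]; simp
  | succ k ih =>
    rw [Function.iterate_succ_apply'] at h0 ⊢
    refine complex_roots_derivative h0 (S := {z : ℂ | z.im = 0 ∧ z.re ∈ Icc (-1 : ℝ) 1}) ?_ ?_
    · exact ((convex_singleton (0 : ℝ)).linear_preimage Complex.imLm).inter
        ((convex_Icc (-1 : ℝ) 1).linear_preimage Complex.reLm)
    · exact ih (by rintro h; simp [h] at h0)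

theorem derivative_legendre_ne_zero {N : ℕ} (hN : 1 ≤ N) : derivative (legendre N) ≠ 0 := by
  intro h
  have h1 := (legendre_roots hN).1
  have h2 := derivative_eq_zero.1 h
  have h3 := (Multiset.toFinset_card_le _).trans (card_roots' (legendre N))
  omega

theorem derivative_legendre_roots {N : ℕ} (hN : 1 ≤ N) {x : ℝ}
    (hx : (derivative (legendre N)).eval x = 0) : x ∈ Ioo (-1 : ℝ) 1 := by
  have hd := derivative_legendre_ne_zero hN
  obtain ⟨c, hc, hL⟩ := legendre_eq N
  have hne : derivative^[N] ((X ^ 2 - 1 : ℝ[X]) ^ N) ≠ 0 := by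
    rintro h; rw [hL, h] at hd; simp at hd
  have hloc : ∀ z : ℂ, aeval z (legendre N) = 0 → z.im = 0 ∧ z.re ∈ Ioo (-1 : ℝ) 1 := by
    intro z hz
    have hz' : aeval z (derivative^[N] ((X ^ 2 - 1 : ℝ[X]) ^ N)) = 0 := by
      rw [hL, map_mul, aeval_C] at hz
      simpa [hc] using hz
    obtain ⟨him, hre⟩ := complex_roots_iterate_derivative N hne z hz'
    have hzr : z = (algebraMap ℝ ℂ z.re) := Complex.ext (by simp) (by simp [him])
    rw [hzr, aeval_algebraMap_apply, FaithfulSMul.algebraMap_eq_zero_iff, coe_aeval_eq_eval] at hz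
    obtain ⟨-, h1, h2⟩ := legendre_roots hN
    refine ⟨him, lt_of_le_of_ne hre.1 ?_, lt_of_le_of_ne hre.2 ?_⟩
    · intro h; rw [← h] at hz; exact h1 hz
    · intro h; rw [h] at hz; exact h2 hz
  have := complex_roots_derivative hd (S := {z : ℂ | z.im = 0 ∧ z.re ∈ Ioo (-1 : ℝ) 1}) 
    (((convex_singleton (0 : ℝ)).linear_preimage Complex.imLm).inter
        ((convex_Ioo (-1 : ℝ) 1).linear_preimage Complex.reLm)) hloc (algebraMap ℝ ℂ x)
    (by rw [aeval_algebraMap_apply, coe_aeval_eq_eval, hx, map_zero])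
  simpa using this.2

theorem one_sub_sq_ne_zero : (1 - X ^ 2 : ℝ[X]) ≠ 0 := by
  intro h
  have := congrArg (eval 0) h
  simp at this

theorem lobatto_ne_zero {N : ℕ} (hN : 1 ≤ N) : (1 - X ^ 2) * derivative (legendre N) ≠ 0 :=
  mul_ne_zero one_sub_sq_ne_zero (derivative_legendre_ne_zero hN)

theorem mem_nodes {N : ℕ} (hN : 1 ≤ N) {x : ℝ} :
    x ∈ nodes N ↔ x = -1 ∨ x = 1 ∨ (derivative (legendre N)).eval x = 0 := by
  have : (1 - x ^ 2 = 0) ↔ x = -1 ∨ x = 1 := by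
    rw [show 1 - x ^ 2 = (x - -1) * (1 - x) by ring, mul_eq_zero, sub_eq_zero, sub_eq_zero,
      eq_comm (a := (1 : ℝ))]
  rw [nodes, Multiset.mem_toFinset, mem_roots (lobatto_ne_zero hN)]
  simp [this, or_assoc]

theorem neg_one_mem_nodes {N : ℕ} (hN : 1 ≤ N) : -1 ∈ nodes N := (mem_nodes hN).2 (Or.inl rfl)

theorem one_mem_nodes {N : ℕ} (hN : 1 ≤ N) : 1 ∈ nodes N := (mem_nodes hN).2 (Or.inr (Or.inl rfl))

theorem mem_interiorNodes {N : ℕ} (hN : 1 ≤ N) {x : ℝ} :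
    x ∈ interiorNodes N ↔ (derivative (legendre N)).eval x = 0 := by
  rw [interiorNodes, Finset.mem_filter, mem_nodes hN]
  constructor
  · rintro ⟨rfl | rfl | h, h1, h2⟩
    · exact absurd h1 (lt_irrefl _)
    · exact absurd h2 (lt_irrefl _)
    · exact h
  · exact fun h => ⟨Or.inr (Or.inr h), derivative_legendre_roots hN h⟩

theorem interiorNodes_subset (N : ℕ) : interiorNodes N ⊆ nodes N := Finset.filter_subset _ _

theorem ne_of_mem_interiorNodes {N : ℕ} {x : ℝ} (hx : x ∈ interiorNodes N) :
    x ≠ -1 ∧ x ≠ 1 := by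
  obtain ⟨h1, h2⟩ := (Finset.mem_filter.1 hx).2
  exact ⟨h1.ne', h2.ne⟩

theorem mem_nodes_iff {N : ℕ} (hN : 1 ≤ N) {x : ℝ} :
    x ∈ nodes N ↔ x = -1 ∨ x = 1 ∨ x ∈ interiorNodes N := by
  rw [mem_nodes hN, mem_interiorNodes hN]

theorem nodes_eq {N : ℕ} (hN : 1 ≤ N) :
    nodes N = insert (-1) (insert 1 (interiorNodes N)) := by
  ext x; simp [mem_nodes_iff hN]

theorem sum_nodes {N : ℕ} (hN : 1 ≤ N) {M : Type*} [AddCommMonoid M] (F : ℝ → M) :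
    ∑ x ∈ nodes N, F x = F (-1) + (F 1 + ∑ x ∈ interiorNodes N, F x) := by
  rw [nodes_eq hN, Finset.sum_insert, Finset.sum_insert]
  · exact fun h => (ne_of_mem_interiorNodes h).2 rfl
  · rw [Finset.mem_insert, not_or]
    exact ⟨by norm_num, fun h => (ne_of_mem_interiorNodes h).1 rfl⟩

theorem natDegree_lobatto_le (N : ℕ) :
    ((1 - X ^ 2) * derivative (legendre N)).natDegree ≤ 2 + (N - 1) := by
  refine natDegree_mul_le.trans (Nat.add_le_add ?_ ?_)
  · compute_degree
  · exact (natDegree_derivative_le _).trans (Nat.sub_le_sub_right (natDegree_legendre_le N) 1)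

/-- There are `N + 1` nodes, as many as the degree of `(1 - x ^ 2) * L_N'`. -/
theorem card_nodes {N : ℕ} (hN : 1 ≤ N) : (nodes N).card = N + 1 := by
  apply le_antisymm
  · have := (Multiset.toFinset_card_le _).trans
      ((card_roots' ((1 - X ^ 2) * derivative (legendre N))).trans (natDegree_lobatto_le N))
    rw [nodes]; omega
  · have h1 := (legendre_roots hN).1
    have h2 := card_roots_toFinset_le_derivative (legendre N)
    have h3 : (derivative (legendre N)).roots.toFinset = interiorNodes N := by
      ext x
      rw [Multiset.mem_toFinset, mem_roots (derivative_legendre_ne_zero hN),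
        mem_interiorNodes hN, IsRoot]
    have h4 := sum_nodes hN (fun _ => 1)
    simp only [Finset.sum_const, smul_eq_mul, mul_one] at h4
    rw [h3] at h2
    omega

theorem natDegree_lobatto {N : ℕ} (hN : 1 ≤ N) :
    ((1 - X ^ 2) * derivative (legendre N)).natDegree = N + 1 := by
  have h1 := natDegree_lobatto_le N
  have h2 := (Multiset.toFinset_card_le _).trans
      (card_roots' ((1 - X ^ 2) * derivative (legendre N)))
  have h3 := card_nodes hN
  rw [nodes] at h3
  omega

/-! ### Gauss–Lobatto quadrature -/

/-- The linear functional `p ↦ ∫_{-1}^1 p`. -/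
def integral : ℝ[X] →ₗ[ℝ] ℝ where
  toFun p := ∫ y in (-1 : ℝ)..1, p.eval y
  map_add' p q := by
    simp only [eval_add]
    exact intervalIntegral.integral_add (p.continuous.intervalIntegrable _ _)
      (q.continuous.intervalIntegrable _ _)
  map_smul' c p := by simp

theorem integral_derivative (p : ℝ[X]) : integral (derivative p) = p.eval 1 - p.eval (-1) :=
  intervalIntegral.integral_eq_sub_of_hasDerivAt (fun x _ => p.hasDerivAt x)
    ((derivative p).continuous.intervalIntegrable _ _)

theorem integral_derivative_mul (p q : ℝ[X]) : integral (derivative p * q)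
    = p.eval 1 * q.eval 1 - p.eval (-1) * q.eval (-1) - integral (p * derivative q) := by
  have := integral_derivative (p * q)
  rw [derivative_mul, map_add, eval_mul, eval_mul] at this
  linarith

theorem integral_pos {p : ℝ[X]} (hp : p ≠ 0) (h : ∀ x ∈ Ioo (-1 : ℝ) 1, 0 ≤ p.eval x) :
    0 < integral p := by
  have hc : ∀ x ∈ Icc (-1 : ℝ) 1, 0 ≤ p.eval x := by
    intro x hx
    rw [← closure_Ioo (by norm_num : (-1 : ℝ) ≠ 1)] at hx
    exact closure_minimal (t := {x | 0 ≤ p.eval x}) h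
      (isClosed_le continuous_const p.continuous) hx
  obtain ⟨c, hcI, hc0⟩ : ∃ c ∈ Icc (-1 : ℝ) 1, p.eval c ≠ 0 := by
    by_contra! hcon
    exact hp (p.eq_zero_of_infinite_isRoot ((Icc_infinite (by norm_num)).mono hcon))
  exact intervalIntegral.integral_pos (by norm_num) p.continuous.continuousOn
    (fun x hx => hc x (Ioc_subset_Icc_self hx)) ⟨c, hcI, (hc c hcI).lt_of_ne' hc0⟩

theorem degree_derivative_lt_of_degree_lt_succ {p : ℝ[X]} {k : ℕ}
    (hp : p.degree < ((k + 1 : ℕ) : WithBot ℕ)) : (derivative p).degree < (k : WithBot ℕ) := by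
  rcases eq_or_ne p 0 with rfl | h0
  · simp
  · have h1 := (natDegree_lt_iff_degree_lt h0).2 hp
    exact (degree_derivative_lt h0).trans_le (degree_le_of_natDegree_le (by omega))

theorem integral_mul_iterate_derivative {N k : ℕ} (hk : k ≤ N) {q : ℝ[X]}
    (hq : q.degree < (k : WithBot ℕ)) :
    integral (q * derivative^[k] ((X ^ 2 - 1) ^ N)) = 0 := by
  induction k generalizing q with
  | zero =>
    have : q = 0 := by simpa using hq
    simp [this]
  | succ k ih =>
    have h1 := eval_iterate_derivative_eq_zero hk (e := 1) (by norm_num)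
    have h2 := eval_iterate_derivative_eq_zero hk (e := -1) (by norm_num)
    rw [Function.iterate_succ_apply', mul_comm, integral_derivative_mul, h1, h2,
      mul_comm _ (derivative q), ih (by omega) (degree_derivative_lt_of_degree_lt_succ hq)]
    simp

/-- Rodrigues' formula makes `L_N` orthogonal to the polynomials of lower degree. -/
theorem integral_mul_legendre {N : ℕ} {q : ℝ[X]} (hq : q.degree < (N : WithBot ℕ)) :
    integral (q * legendre N) = 0 := by
  obtain ⟨c, -, h⟩ := legendre_eq N
  rw [h, mul_left_comm, ← smul_eq_C_mul, map_smul, integral_mul_iterate_derivative le_rfl hq,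
    smul_zero]

/-- Orthogonality of the derivatives `L_N'` for the weight `1 - x ^ 2`. -/
theorem integral_mul_lobatto {N : ℕ} {q : ℝ[X]}
    (hq : ((1 - X ^ 2) * q).degree < ((N + 1 : ℕ) : WithBot ℕ)) :
    integral ((1 - X ^ 2) * derivative (legendre N) * q) = 0 := by
  have := integral_derivative_mul (legendre N) ((1 - X ^ 2) * q)
  rw [mul_comm (legendre N),
    integral_mul_legendre (degree_derivative_lt_of_degree_lt_succ hq)] at this
  rw [mul_assoc, mul_left_comm, this]
  simp

theorem eval_cardinal_self {N : ℕ} {x : ℝ} (hx : x ∈ nodes N) : (cardinal N x).eval x = 1 :=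
  Lagrange.eval_basis_self (v := id) (injOn_id _) hx

theorem eval_cardinal_of_ne {N : ℕ} {x y : ℝ} (hy : y ∈ nodes N) (hxy : x ≠ y) :
    (cardinal N x).eval y = 0 :=
  Lagrange.eval_basis_of_ne (v := id) hxy hy

theorem degree_cardinal {N : ℕ} (hN : 1 ≤ N) {x : ℝ} (hx : x ∈ nodes N) :
    (cardinal N x).degree ≤ (N : WithBot ℕ) := by
  rw [cardinal, Lagrange.degree_basis (injOn_id _) hx, card_nodes hN, Nat.add_sub_cancel]

theorem natDegree_cardinal {N : ℕ} (hN : 1 ≤ N) {x : ℝ} (hx : x ∈ nodes N) :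
    (cardinal N x).natDegree ≤ N := natDegree_le_of_degree_le (degree_cardinal hN hx)

theorem eq_of_eval_nodes {N : ℕ} (hN : 1 ≤ N) {p q : ℝ[X]} (hp : p.natDegree ≤ N)
    (hq : q.natDegree ≤ N) (h : ∀ x ∈ nodes N, p.eval x = q.eval x) : p = q := by
  have key : ∀ r : ℝ[X], r.natDegree ≤ N → r.degree < ((nodes N).card : WithBot ℕ) := by
    intro r hr
    rw [card_nodes hN]
    exact (degree_le_of_natDegree_le hr).trans_lt (by exact_mod_cast Nat.lt_succ_self N)
  exact eq_of_degrees_lt_of_eval_finset_eq _ (key p hp) (key q hq) h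

theorem eval_sum_cardinal {N : ℕ} {s : Finset ℝ} (a : ℝ → ℝ) {y : ℝ}
    (hy : y ∈ nodes N) :
    (∑ x ∈ s, C (a x) * cardinal N x).eval y = if y ∈ s then a y else 0 := by
  simp only [eval_finsetSum, eval_mul, eval_C]
  split_ifs with h
  · rw [Finset.sum_eq_single_of_mem y h, eval_cardinal_self hy, mul_one]
    intro x _ hx
    rw [eval_cardinal_of_ne hy hx, mul_zero]
  · refine Finset.sum_eq_zero fun x hx => ?_
    rw [eval_cardinal_of_ne hy (by rintro rfl; exact h hx), mul_zero]

theorem natDegree_sum_cardinal {N : ℕ} (hN : 1 ≤ N) {s : Finset ℝ} (hs : s ⊆ nodes N)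
    (a : ℝ → ℝ) : (∑ x ∈ s, C (a x) * cardinal N x).natDegree ≤ N :=
  natDegree_sum_le_of_forall_le _ _ fun _ hx =>
    (natDegree_C_mul_le _ _).trans (natDegree_cardinal hN (hs hx))

/-- The Gauss–Lobatto formula is exact up to degree `2N - 1`: after division by
`(1 - x ^ 2) * L_N'`, the remainder is integrated exactly by interpolation and the quotient
contributes nothing by orthogonality. -/
theorem integral_eq_sum_nodes {N : ℕ} (hN : 1 ≤ N) {p : ℝ[X]} (hp : p.natDegree ≤ 2 * N - 1) :
    integral p = ∑ x ∈ nodes N, weight N x * p.eval x := by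
  set M : ℝ[X] := (1 - X ^ 2) * derivative (legendre N) with hM
  have hM0 : M ≠ 0 := lobatto_ne_zero hN
  have hMd : M.natDegree = N + 1 := natDegree_lobatto hN
  have hdiv := EuclideanDomain.div_add_mod p M
  have hr : (p % M).natDegree ≤ N := by
    have := natDegree_mod_lt p (q := M) (by omega)
    omega
  have hq : integral (M * (p / M)) = 0 := by
    rcases eq_or_ne (p / M) 0 with h | h
    · simp [h]
    refine integral_mul_lobatto ?_
    have hlt : ¬ p.degree < M.degree := fun hlt => h ((Polynomial.div_eq_zero_iff hM0).2 hlt)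
    have h1 : M.natDegree ≤ p.natDegree := natDegree_le_natDegree (not_lt.1 hlt)
    have h2 : ((1 - X ^ 2) * (p / M) : ℝ[X]).natDegree ≤ 2 + (p.natDegree - M.natDegree) := by
      refine natDegree_mul_le.trans (Nat.add_le_add (by compute_degree) ?_)
      have h3 := degree_add_div hM0 (not_lt.1 hlt)
      rw [← degree_mul] at h3
      have h4 := natDegree_eq_of_degree_eq h3
      rw [natDegree_mul hM0 h] at h4
      omega
    exact (degree_le_of_natDegree_le h2).trans_lt (by exact_mod_cast (by omega))
  have heval : ∀ x ∈ nodes N, (p % M).eval x = p.eval x := by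
    intro x hx
    have hMx : M.eval x = 0 := by
      rw [nodes, Multiset.mem_toFinset, mem_roots hM0] at hx
      exact hx
    conv_rhs => rw [← hdiv]
    simp [hMx]
  have hinterp : p % M = ∑ x ∈ nodes N, C ((p % M).eval x) * cardinal N x := by
    refine eq_of_eval_nodes hN hr (natDegree_sum_cardinal hN subset_rfl _) fun y hy => ?_
    rw [eval_sum_cardinal _ hy, if_pos hy]
  calc integral p = integral (M * (p / M)) + integral (p % M) := by rw [← map_add, hdiv]
    _ = integral (∑ x ∈ nodes N, C ((p % M).eval x) * cardinal N x) := by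
      rw [hq, zero_add, ← hinterp]
    _ = ∑ x ∈ nodes N, weight N x * p.eval x := by
      rw [map_sum]
      refine Finset.sum_congr rfl fun x hx => ?_
      rw [← smul_eq_C_mul, map_smul, heval x hx, smul_eq_mul, mul_comm]
      rfl

theorem weight_mul_eval {N : ℕ} (hN : 1 ≤ N) {p : ℝ[X]} (hp : p.natDegree ≤ 2 * N - 1) {x : ℝ}
    (hx : x ∈ nodes N) (h : ∀ y ∈ nodes N, y ≠ x → p.eval y = 0) :
    weight N x * p.eval x = integral p := by
  rw [integral_eq_sum_nodes hN hp, Finset.sum_eq_single_of_mem x hx]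
  intro y hy hyx
  rw [h y hy hyx, mul_zero]

theorem weight_pos_of_test {N : ℕ} (hN : 1 ≤ N) {p : ℝ[X]} (hp : p.natDegree ≤ 2 * N - 1) {x : ℝ}
    (hx : x ∈ nodes N) (h : ∀ y ∈ nodes N, y ≠ x → p.eval y = 0) (hp0 : p ≠ 0)
    (hpos : ∀ y ∈ Ioo (-1 : ℝ) 1, 0 ≤ p.eval y) (hpx : 0 ≤ p.eval x) : 0 < weight N x := by
  have h1 := weight_mul_eval hN hp hx h
  have h2 := integral_pos hp0 hpos
  rw [← h1] at h2
  exact pos_of_mul_pos_left h2 hpx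

/-- The end weights are positive: test the quadrature with `(1 ± x) * (L_N') ^ 2`. -/
theorem weight_end_pos {N : ℕ} (hN : 1 ≤ N) {e : ℝ} (he : e = 1 ∨ e = -1) : 0 < weight N e := by
  have hd := derivative_legendre_ne_zero hN
  have hl : (1 + C e * X : ℝ[X]) ≠ 0 := by
    intro h
    have := congrArg (eval 0) h
    simp at this
  have hx : e ∈ nodes N := (mem_nodes_iff hN).2 (by tauto)
  refine weight_pos_of_test hN (p := (1 + C e * X) * derivative (legendre N) ^ 2) ?_ hx ?_
    (mul_ne_zero hl (pow_ne_zero _ hd)) ?_ ?_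
  · have h1 : (1 + C e * X : ℝ[X]).natDegree ≤ 1 := by compute_degree
    have h2 : (derivative (legendre N) ^ 2).natDegree ≤ 2 * (N - 1) :=
      natDegree_pow_le_of_le 2 ((natDegree_derivative_le _).trans
        (Nat.sub_le_sub_right (natDegree_legendre_le N) 1))
    exact (natDegree_mul_le_of_le h1 h2).trans (by omega)
  · intro y hy hye
    rcases (mem_nodes_iff hN).1 hy with h | h | h
    · rcases he with rfl | rfl
      · simp [h]
      · exact absurd h hye
    · rcases he with rfl | rfl
      · exact absurd h hye
      · simp [h]
    · simp [(mem_interiorNodes hN).1 h]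
  · intro y hy
    have : 0 ≤ 1 + e * y := by rcases he with rfl | rfl <;> linarith [hy.1, hy.2]
    simp only [eval_mul, eval_add, eval_one, eval_C, eval_X, eval_pow]
    positivity
  · have : e * e = 1 := by rcases he with rfl | rfl <;> norm_num
    simp only [eval_mul, eval_add, eval_one, eval_C, eval_X, eval_pow, this]
    positivity

/-- The interior weights are positive: if `L_N' = (x - x_i) q`, test the quadrature with
`(1 - x ^ 2) * q ^ 2`. -/
theorem weight_interior_pos {N : ℕ} (hN : 1 ≤ N) {x : ℝ} (hx : x ∈ interiorNodes N) :
    0 < weight N x := by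
  have hd := derivative_legendre_ne_zero hN
  obtain ⟨q, hq⟩ := dvd_iff_isRoot.2 ((mem_interiorNodes hN).1 hx)
  have hq0 : q ≠ 0 := by rintro rfl; exact hd (by rw [hq, mul_zero])
  have hqd : q.natDegree + 1 ≤ N - 1 := by
    have h1 := (natDegree_derivative_le (legendre N)).trans
        (Nat.sub_le_sub_right (natDegree_legendre_le N) 1)
    rw [hq, natDegree_mul (X_sub_C_ne_zero x) hq0, natDegree_X_sub_C] at h1
    omega
  refine weight_pos_of_test hN (p := (1 - X ^ 2) * q ^ 2) ?_ (interiorNodes_subset N hx) ?_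
    (mul_ne_zero one_sub_sq_ne_zero (pow_ne_zero _ hq0)) ?_ ?_
  · have h1 : (1 - X ^ 2 : ℝ[X]).natDegree ≤ 2 := by compute_degree
    exact (natDegree_mul_le_of_le h1 (natDegree_pow_le (p := q) (n := 2))).trans (by omega)
  · intro y hy hyx
    rcases (mem_nodes_iff hN).1 hy with h | h | h
    · simp [h]
    · simp [h]
    · have := (mem_interiorNodes hN).1 h
      rw [hq, eval_mul, eval_sub, eval_X, eval_C] at this
      have := (mul_eq_zero.1 this).resolve_left (sub_ne_zero.2 hyx)
      simp [this]
  · intro y hy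
    have : 0 ≤ 1 - y ^ 2 := by nlinarith [hy.1, hy.2]
    simp only [eval_mul, eval_sub, eval_one, eval_X, eval_pow]
    positivity
  · have hI := (Finset.mem_filter.1 hx).2
    have : 0 ≤ 1 - x ^ 2 := by nlinarith [hI.1, hI.2]
    simp only [eval_mul, eval_sub, eval_one, eval_X, eval_pow]
    positivity

/-! ### The collocation operator and its observability -/

/-- The polynomial of degree at most `N` with prescribed values at the interior nodes and value
`0` at `-1` and `1`. -/
def interp (N : ℕ) : (interiorNodes N → ℝ) →ₗ[ℝ] ℝ[X] :=
  ∑ x : interiorNodes N, (LinearMap.proj x).smulRight (cardinal N x)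

theorem interp_apply (N : ℕ) (y : interiorNodes N → ℝ) :
    interp N y = ∑ x : interiorNodes N, C (y x) * cardinal N x := by
  simp [interp, LinearMap.sum_apply, smul_eq_C_mul]

theorem eval_interp {N : ℕ} (y : interiorNodes N → ℝ) (x : interiorNodes N) :
    (interp N y).eval x.1 = y x := by
  have hx := interiorNodes_subset N x.2
  simp only [interp_apply, eval_finsetSum, eval_mul, eval_C]
  rw [Finset.sum_eq_single_of_mem x (Finset.mem_univ _), eval_cardinal_self hx, mul_one]
  intro z _ hz
  rw [eval_cardinal_of_ne hx (fun h => hz (Subtype.ext h)), mul_zero]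

theorem eval_interp_end {N : ℕ} (hN : 1 ≤ N) (y : interiorNodes N → ℝ) {e : ℝ}
    (he : e = 1 ∨ e = -1) : (interp N y).eval e = 0 := by
  have he' : e ∈ nodes N := (mem_nodes_iff hN).2 (by tauto)
  simp only [interp_apply, eval_finsetSum, eval_mul, eval_C]
  refine Finset.sum_eq_zero fun x _ => ?_
  rw [eval_cardinal_of_ne he', mul_zero]
  have := ne_of_mem_interiorNodes x.2
  rcases he with rfl | rfl
  · exact this.2
  · exact this.1

theorem natDegree_interp {N : ℕ} (hN : 1 ≤ N) (y : interiorNodes N → ℝ) :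
    (interp N y).natDegree ≤ N := by
  rw [interp_apply]
  exact natDegree_sum_le_of_forall_le _ _ fun x _ =>
    (natDegree_C_mul_le _ _).trans (natDegree_cardinal hN (interiorNodes_subset N x.2))

theorem sum_interior_eq_interp {N : ℕ} (a : ℝ → ℝ) :
    ∑ x ∈ interiorNodes N, C (a x) * cardinal N x = interp N fun x => a x := by
  rw [interp_apply, ← Finset.sum_coe_sort]

/-- The second derivative at the interior nodes, with homogeneous Dirichlet conditions. -/
def collocation (N : ℕ) : (interiorNodes N → ℝ) →ₗ[ℝ] (interiorNodes N → ℝ) :=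
  LinearMap.pi fun x => leval x.1 ∘ₗ derivative ∘ₗ derivative ∘ₗ interp N

theorem collocation_apply (N : ℕ) (y : interiorNodes N → ℝ) (x : interiorNodes N) :
    collocation N y x = (derivative (derivative (interp N y))).eval x.1 := rfl

theorem natDegree_derivative_le_of_le {p : ℝ[X]} {n : ℕ} (hp : p.natDegree ≤ n) :
    (derivative p).natDegree ≤ n - 1 :=
  (natDegree_derivative_le p).trans (Nat.sub_le_sub_right hp 1)

theorem sum_interior_mul {N : ℕ} (hN : 1 ≤ N) {p q : ℝ[X]} (h : (p * q).natDegree ≤ 2 * N - 1)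
    (h1 : q.eval (-1) = 0) (h2 : q.eval 1 = 0) :
    ∑ x : interiorNodes N, weight N x * (p.eval x.1 * q.eval x.1) = integral (p * q) := by
  rw [integral_eq_sum_nodes hN h, sum_nodes hN,
    Finset.sum_coe_sort (interiorNodes N) fun x => weight N x * (p.eval x * q.eval x)]
  simp [h1, h2]

theorem integral_second_derivative_mul {p q : ℝ[X]} (hp1 : p.eval (-1) = 0) (hp2 : p.eval 1 = 0)
    (hq1 : q.eval (-1) = 0) (hq2 : q.eval 1 = 0) :
    integral (derivative (derivative p) * q) = integral (derivative (derivative q) * p) := by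
  rw [integral_derivative_mul, integral_derivative_mul (derivative q), hp1, hp2, hq1, hq2,
    mul_comm (derivative q)]
  ring

theorem natDegree_second_derivative_mul {N : ℕ} (hN : 1 ≤ N) {p q : ℝ[X]} (hp : p.natDegree ≤ N)
    (hq : q.natDegree ≤ N) : (derivative (derivative p) * q).natDegree ≤ 2 * N - 1 :=
  (natDegree_mul_le_of_le (natDegree_derivative_le_of_le (natDegree_derivative_le_of_le hp))
    hq).trans (by omega)

/-- By exactness of the quadrature for `p'' q`, of degree at most `2N - 2`, the collocation operator is symmetric for the discrete inner
product. -/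
theorem collocation_symmetric {N : ℕ} (hN : 1 ≤ N) (a y : interiorNodes N → ℝ) :
    ∑ x : interiorNodes N, weight N x * (collocation N y x * a x) = ∑ x : interiorNodes N, weight N x * (collocation N a x * y x) := by
  have key : ∀ a y : interiorNodes N → ℝ, ∑ x : interiorNodes N, weight N x * (collocation N y x * a x)
      = integral (derivative (derivative (interp N y)) * interp N a) := by
    intro a y
    rw [← sum_interior_mul hN (natDegree_second_derivative_mul hN (natDegree_interp hN y)
      (natDegree_interp hN a)) (eval_interp_end hN a (Or.inr rfl))
      (eval_interp_end hN a (Or.inl rfl))]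
    simp only [eval_interp, collocation_apply]
  rw [key, key]
  exact integral_second_derivative_mul (eval_interp_end hN _ (Or.inr rfl))
      (eval_interp_end hN _ (Or.inl rfl)) (eval_interp_end hN _ (Or.inr rfl))
      (eval_interp_end hN _ (Or.inl rfl))

/-- The term `h''` of a profile sees `φ'(e)` and `φ''(e)`. -/
theorem sum_lift {N : ℕ} (hN : 1 ≤ N) {e : ℝ} (he : e = 1 ∨ e = -1) (a : interiorNodes N → ℝ) :
    ∑ x : interiorNodes N, weight N x *
      ((derivative (derivative (interp N fun x => (1 + e * x) / 2))).eval x.1 * a x)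
      = e * (derivative (interp N a)).eval e
        - weight N e * (derivative (derivative (interp N a))).eval e := by
  change ∑ x : interiorNodes N, weight N x * (collocation N (fun x => (1 + e * x) / 2) x * a x) = _
  rw [collocation_symmetric hN]
  set φ := interp N a with hφ
  have hφd : φ.natDegree ≤ N := natDegree_interp hN a
  have h1 : φ.eval 1 = 0 := eval_interp_end hN a (Or.inl rfl)
  have h2 : φ.eval (-1) = 0 := eval_interp_end hN a (Or.inr rfl)
  have hdeg : (derivative (derivative φ) * (C (1 / 2) + C (e / 2) * X)).natDegree
      ≤ 2 * N - 1 := by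
    have h : (C (1 / 2) + C (e / 2) * X : ℝ[X]).natDegree ≤ 1 := by compute_degree
    exact (natDegree_mul_le_of_le (natDegree_derivative_le_of_le
      (natDegree_derivative_le_of_le hφd)) h).trans (by omega)
  have hq := integral_eq_sum_nodes hN hdeg
  rw [integral_derivative_mul, sum_nodes hN] at hq
  have hz : integral (derivative φ * derivative (C (1 / 2) + C (e / 2) * X)) = 0 := by
    rw [integral_derivative_mul, h1, h2]
    simp
  rw [hz] at hq
  have hs : ∑ x : interiorNodes N, weight N x * (collocation N a x * ((1 + e * x) / 2))
      = ∑ x ∈ interiorNodes N, weight N x *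
        (derivative (derivative φ) * (C (1 / 2) + C (e / 2) * X)).eval x := by
    refine Eq.trans ?_ (Finset.sum_coe_sort (interiorNodes N) fun x => weight N x *
      (derivative (derivative φ) * (C (1 / 2) + C (e / 2) * X)).eval x)
    refine Finset.sum_congr rfl fun x _ => ?_
    rw [collocation_apply, eval_mul]
    simp only [eval_add, eval_mul, eval_C, eval_X]
    ring
  rw [hs]
  simp only [eval_add, eval_mul, eval_C, eval_X] at hq ⊢
  rcases he with rfl | rfl
  · linear_combination -hq
  · linear_combination -hq

/-- The term `Ψ_e'` of a profile sees `φ'(e)`, because the quadrature formula of the product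
`Ψ_e φ'` reduces to the node `e`. -/
theorem sum_derivative_cardinal {N : ℕ} (hN : 1 ≤ N) {e : ℝ} (he : e = 1 ∨ e = -1)
    (a : interiorNodes N → ℝ) :
    ∑ x : interiorNodes N, weight N x * ((derivative (cardinal N e)).eval x.1 * a x)
      = -(weight N e * (derivative (interp N a)).eval e) := by
  have hx : e ∈ nodes N := (mem_nodes_iff hN).2 (by tauto)
  have h1 := eval_interp_end hN a (Or.inl rfl)
  have h2 := eval_interp_end hN a (Or.inr rfl)
  have hd1 := natDegree_cardinal hN hx
  have hd2 := natDegree_interp hN a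
  have hw : weight N e * (cardinal N e * derivative (interp N a)).eval e
      = integral (cardinal N e * derivative (interp N a)) := by
    refine weight_mul_eval hN ((natDegree_mul_le_of_le hd1
      (natDegree_derivative_le_of_le hd2)).trans (by omega)) hx fun y hy hye => ?_
    rw [eval_mul, eval_cardinal_of_ne hy (Ne.symm hye), zero_mul]
  have hs := sum_interior_mul hN (p := derivative (cardinal N e)) ((natDegree_mul_le_of_le
      (natDegree_derivative_le_of_le hd1) hd2).trans (by omega)) h2 h1
  simp only [eval_interp] at hs
  rw [hs, integral_derivative_mul, h1, h2, ← hw, eval_mul, eval_cardinal_self hx]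
  ring

/-- In a profile the contributions of `φ'(e)` cancel: a profile control observes exactly the
defect `φ''(e)` of the homogeneous collocation equation at the end point `e`. -/
theorem sum_profileL {N : ℕ} (hN : 1 ≤ N) (a : interiorNodes N → ℝ) :
    ∑ x : interiorNodes N, weight N x * ((profileL N).eval x.1 * a x)
      = -(1 / √(weight N (-1)) * (weight N (-1) *
          (derivative (derivative (interp N a))).eval (-1))) := by
  have hw := weight_end_pos hN (Or.inr rfl : (-1 : ℝ) = 1 ∨ (-1 : ℝ) = -1)
  have hsq := Real.sqrt_pos.2 hw
  have h1 := sum_lift hN (Or.inr rfl) a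
  have h2 := sum_derivative_cardinal hN (Or.inr rfl) a
  have hh : hL N = interp N fun x => (1 + -1 * x) / 2 := by
    rw [hL, sum_interior_eq_interp]
    congr 1; funext x; ring
  have hs : ∑ x : interiorNodes N, weight N x * ((profileL N).eval x.1 * a x)
      = 1 / √(weight N (-1)) * ∑ x : interiorNodes N, weight N x *
        ((derivative (derivative (interp N fun x => (1 + -1 * x) / 2))).eval x.1 * a x)
        - 1 / (√(weight N (-1)) * weight N (-1)) * ∑ x : interiorNodes N, weight N x *
          ((derivative (cardinal N (-1))).eval x.1 * a x) := by
    rw [Finset.mul_sum, Finset.mul_sum, ← Finset.sum_sub_distrib]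
    refine Finset.sum_congr rfl fun x _ => ?_
    rw [profileL, hh, eval_sub, eval_mul, eval_mul, eval_C, eval_C]
    ring
  rw [hs, h1, h2]
  field_simp
  ring

theorem sum_profileR {N : ℕ} (hN : 1 ≤ N) (a : interiorNodes N → ℝ) :
    ∑ x : interiorNodes N, weight N x * ((profileR N).eval x.1 * a x)
      = -(1 / √(weight N 1) * (weight N 1 *
          (derivative (derivative (interp N a))).eval 1)) := by
  have hw := weight_end_pos hN (Or.inl rfl : (1 : ℝ) = 1 ∨ (1 : ℝ) = -1)
  have hsq := Real.sqrt_pos.2 hw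
  have h1 := sum_lift hN (Or.inl rfl) a
  have h2 := sum_derivative_cardinal hN (Or.inl rfl) a
  have hh : hR N = interp N fun x => (1 + 1 * x) / 2 := by
    rw [hR, sum_interior_eq_interp]
    congr 1; funext x; ring
  have hs : ∑ x : interiorNodes N, weight N x * ((profileR N).eval x.1 * a x)
      = 1 / √(weight N 1) * ∑ x : interiorNodes N, weight N x *
        ((derivative (derivative (interp N fun x => (1 + 1 * x) / 2))).eval x.1 * a x)
        + 1 / (√(weight N 1) * weight N 1) * ∑ x : interiorNodes N, weight N x *
          ((derivative (cardinal N 1)).eval x.1 * a x) := by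
    rw [Finset.mul_sum, Finset.mul_sum, ← Finset.sum_add_distrib]
    refine Finset.sum_congr rfl fun x _ => ?_
    rw [profileR, hh, eval_add, eval_mul, eval_mul, eval_C, eval_C]
    ring
  rw [hs, h1, h2]
  field_simp
  ring

theorem eq_zero_of_second_derivative_eq_zero {p : ℝ[X]} (h : derivative (derivative p) = 0)
    (h1 : p.eval 1 = 0) (h2 : p.eval (-1) = 0) : p = 0 := by
  have h3 := derivative_eq_zero.1 h
  obtain ⟨c, hc⟩ := natDegree_eq_zero.1 h3
  have h4 : derivative (p - C c * X) = 0 := by rw [derivative_sub, ← hc]; simp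
  obtain ⟨d, hd⟩ := natDegree_eq_zero.1 (derivative_eq_zero.1 h4)
  have hp : p = C c * X + C d := by rw [hd]; ring
  rw [hp] at h1 h2 ⊢
  simp at h1 h2
  have hd0 : d = 0 := by linarith
  have hc0 : c = 0 := by linarith
  simp [hc0, hd0]

/-- Every functional is represented by the discrete inner product, the weights being nonzero. -/
theorem exists_weights {N : ℕ} (hN : 1 ≤ N) (ψ : (interiorNodes N → ℝ) →ₗ[ℝ] ℝ) :
    ∃ a : interiorNodes N → ℝ, ∀ y, ψ y = ∑ x : interiorNodes N, weight N x * (y x * a x) := by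
  classical
  refine ⟨fun x => ψ (fun j => if x = j then 1 else 0) / weight N x, fun y => ?_⟩
  rw [LinearMap.pi_apply_eq_sum_univ ψ y]
  refine Finset.sum_congr rfl fun x _ => ?_
  have := (weight_interior_pos hN x.2).ne'
  rw [smul_eq_mul]
  field_simp

/-- If no profile control sees the functional `ψ = ⟨φ, ·⟩` along the collocation dynamics, then
`φ''` vanishes at both ends, and so do the second derivatives of the iterates. The collocation
operator is then the exact second derivative on these iterates, hence nilpotent, and a polynomial
vanishing at both ends with zero second derivative is zero. -/
theorem collocation_observable {N : ℕ} (hN : 1 ≤ N) (ψ : (interiorNodes N → ℝ) →ₗ[ℝ] ℝ)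
    (hL : ∀ k, ψ ((collocation N)^[k] fun x => (profileL N).eval x.1) = 0)
    (hR : ∀ k, ψ ((collocation N)^[k] fun x => (profileR N).eval x.1) = 0) : ψ = 0 := by
  obtain ⟨a, ha⟩ := exists_weights hN ψ
  have htrans : ∀ (k : ℕ) (a y : interiorNodes N → ℝ),
      ∑ x : interiorNodes N, weight N x * ((collocation N)^[k] y x * a x)
        = ∑ x : interiorNodes N, weight N x * (y x * (collocation N)^[k] a x) := by
    intro k
    induction k with
    | zero => intro a y; rfl
    | succ k ih =>
      intro a y
      rw [Function.iterate_succ_apply', collocation_symmetric hN, Function.iterate_succ_apply,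
        ← ih (collocation N a) y]
      exact Finset.sum_congr rfl fun x _ => by ring
  have hend : ∀ k, (derivative (derivative (interp N ((collocation N)^[k] a)))).eval (-1) = 0 ∧
      (derivative (derivative (interp N ((collocation N)^[k] a)))).eval 1 = 0 := by
    intro k
    have h1 := hL k
    have h2 := hR k
    rw [ha, htrans, sum_profileL hN] at h1
    rw [ha, htrans, sum_profileR hN] at h2
    have hw1 := weight_end_pos hN (Or.inl rfl : (1 : ℝ) = 1 ∨ (1 : ℝ) = -1)
    have hw2 := weight_end_pos hN (Or.inr rfl : (-1 : ℝ) = 1 ∨ (-1 : ℝ) = -1)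
    have hs1 := Real.sqrt_pos.2 hw1
    have hs2 := Real.sqrt_pos.2 hw2
    constructor
    · simpa [hw2.ne', hs2.ne'] using h1
    · simpa [hw1.ne', hs1.ne'] using h2
  have hstep : ∀ k, interp N ((collocation N)^[k + 1] a)
      = derivative (derivative (interp N ((collocation N)^[k] a))) := by
    intro k
    refine eq_of_eval_nodes hN (natDegree_interp hN _)
      ((natDegree_derivative_le_of_le (natDegree_derivative_le_of_le
        (natDegree_interp hN _))).trans (by omega)) fun x hx => ?_
    rcases (mem_nodes_iff hN).1 hx with rfl | rfl | hx
    · rw [eval_interp_end hN _ (Or.inr rfl), (hend k).1]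
    · rw [eval_interp_end hN _ (Or.inl rfl), (hend k).2]
    · rw [eval_interp _ ⟨x, hx⟩, Function.iterate_succ_apply', collocation_apply]
  have hdeg : ∀ k, (interp N ((collocation N)^[k] a)).natDegree ≤ N - k := by
    intro k
    induction k with
    | zero => exact natDegree_interp hN _
    | succ k ih =>
      rw [hstep]
      exact (natDegree_derivative_le_of_le (natDegree_derivative_le_of_le ih)).trans (by omega)
  have hback : ∀ k, interp N ((collocation N)^[k] a) = 0 → interp N a = 0 := by
    intro k
    induction k with
    | zero => exact id
    | succ k ih =>
      intro h
      rw [hstep] at h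
      exact ih (eq_zero_of_second_derivative_eq_zero h (eval_interp_end hN _ (Or.inl rfl))
        (eval_interp_end hN _ (Or.inr rfl)))
  have h0 : interp N a = 0 := by
    refine hback N ?_
    have h := hdeg N
    refine eq_zero_of_second_derivative_eq_zero ?_ (eval_interp_end hN _ (Or.inl rfl))
        (eval_interp_end hN _ (Or.inr rfl))
    rw [derivative_of_natDegree_zero (p := interp N ((collocation N)^[N] a)) (by omega),
      derivative_zero]
  have ha0 : a = 0 := by
    funext x
    rw [← eval_interp a x, h0]
    simp
  refine LinearMap.ext fun y => ?_
  simp [ha, ha0]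

/-! ### Controllability of finite-dimensional linear systems -/

/-- Solutions of a linear system with smooth forcing are smooth, by bootstrapping. -/
theorem contDiff_of_linear_ode {Z : Type*} [NormedAddCommGroup Z] [NormedSpace ℝ Z]
    (A : Z →L[ℝ] Z) {z h : ℝ → Z} (hh : ContDiff ℝ ∞ h)
    (hz : ∀ t, HasDerivAt z (A (z t) + h t) t) : ContDiff ℝ ∞ z := by
  refine contDiff_infty.2 fun n => ?_
  induction n with
  | zero =>
    exact contDiff_zero.2 (continuous_iff_continuousAt.2 fun t => (hz t).continuousAt)
  | succ n ih =>
    push_cast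
    refine contDiff_succ_iff_deriv.2 ⟨fun t => (hz t).differentiableAt, by simp, ?_⟩
    rw [funext fun t => (hz t).deriv]
    exact (A.contDiff.comp ih).add (hh.of_le (by exact_mod_cast le_top))

section Control

variable {Z : Type*} [NormedAddCommGroup Z] [NormedSpace ℝ Z] [FiniteDimensional ℝ Z]

/-- The flow `exp (t A)` of the linear vector field `A`. -/
def flow (A : Z →L[ℝ] Z) (t : ℝ) : Z →L[ℝ] Z := NormedSpace.exp (t • A)

theorem hasDerivAt_flow (A : Z →L[ℝ] Z) (t : ℝ) : HasDerivAt (flow A) (flow A t * A) t :=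
  have : CompleteSpace Z := FiniteDimensional.complete ℝ Z
  hasDerivAt_exp_smul_const A t

theorem hasDerivAt_flow' (A : Z →L[ℝ] Z) (t : ℝ) : HasDerivAt (flow A) (A * flow A t) t :=
  have : CompleteSpace Z := FiniteDimensional.complete ℝ Z
  hasDerivAt_exp_smul_const' A t

theorem hasDerivAt_flow_apply (A : Z →L[ℝ] Z) (v : Z) (t : ℝ) :
    HasDerivAt (fun s => flow A s v) (flow A t (A v)) t := by
  simpa using (hasDerivAt_flow A t).clm_apply (hasDerivAt_const t v)

theorem contDiff_flow_apply (A : Z →L[ℝ] Z) (v : Z) : ContDiff ℝ ∞ fun s => flow A s v := by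
  refine contDiff_of_linear_ode A (h := fun _ => 0) contDiff_const fun t => ?_
  simpa using (hasDerivAt_flow' A t).clm_apply (hasDerivAt_const t v)

theorem continuous_flow (A : Z →L[ℝ] Z) : Continuous (flow A) :=
  continuous_iff_continuousAt.2 fun t => (hasDerivAt_flow A t).continuousAt

theorem flow_flow_neg (A : Z →L[ℝ] Z) (t : ℝ) (v : Z) : flow A t (flow (-A) t v) = v := by
  have : CompleteSpace Z := FiniteDimensional.complete ℝ Z
  let : NormedAlgebra ℚ (Z →L[ℝ] Z) := NormedAlgebra.restrictScalars ℚ ℝ _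
  have h : flow A t * flow (-A) t = 1 := by
    rw [flow, flow, ← NormedSpace.exp_add_of_commute, smul_neg, add_neg_cancel,
      NormedSpace.exp_zero]
    rw [smul_neg]
    exact (Commute.refl _).neg_right
  exact DFunLike.congr_fun h v

theorem flow_neg_flow (A : Z →L[ℝ] Z) (t : ℝ) (v : Z) : flow (-A) t (flow A t v) = v := by
  simpa using flow_flow_neg (-A) t v

/-- A functional whose observation along the flow vanishes on a time interval vanishes on
the Kalman space, by differentiating the observation. -/
theorem apply_flow_pow_eq_zero (A : Z →L[ℝ] Z) (f : Z →L[ℝ] ℝ) (b : Z) {T : ℝ}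
    (h : ∀ t ∈ Ioo 0 T, f (flow (-A) t b) = 0) (k : ℕ) :
    ∀ t ∈ Ioo 0 T, f (flow (-A) t ((A ^ k) b)) = 0 := by
  induction k with
  | zero => simpa using h
  | succ k ih =>
    intro t ht
    have h1 : HasDerivAt (fun s => f (flow (-A) s ((A ^ k) b)))
        (f (flow (-A) t ((-A) ((A ^ k) b)))) t :=
      f.hasFDerivAt.comp_hasDerivAt t (hasDerivAt_flow_apply (-A) ((A ^ k) b) t)
    have h2 : HasDerivAt (fun s => f (flow (-A) s ((A ^ k) b))) 0 t := by
      refine (hasDerivAt_const t (0 : ℝ)).congr_of_eventuallyEq ?_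
      filter_upwards [isOpen_Ioo.mem_nhds ht] with s hs using ih s hs
    have h3 := h1.unique h2
    rw [pow_succ']
    simpa using h3

variable {ι : Type*} [Fintype ι]

/-- The states `∫_0^T exp (-s A) ∑ c_j(s) b_j ds` reached with smooth controls `c_j`, transported
back to the initial time. -/
def reachable (A : Z →L[ℝ] Z) (b : ι → Z) (T : ℝ) : Submodule ℝ Z where
  carrier := {w | ∃ c : ι → ℝ → ℝ, (∀ j, ContDiff ℝ ∞ (c j)) ∧
    ∫ s in (0 : ℝ)..T, flow (-A) s (∑ j, c j s • b j) = w}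
  zero_mem' := ⟨fun _ _ => 0, fun _ => contDiff_const, by simp⟩
  add_mem' := by
    rintro _ _ ⟨c, hc, rfl⟩ ⟨d, hd, rfl⟩
    refine ⟨fun j s => c j s + d j s, fun j => (hc j).add (hd j), ?_⟩
    have hi : ∀ c : ι → ℝ → ℝ, (∀ j, ContDiff ℝ ∞ (c j)) → IntervalIntegrable
        (fun s => flow (-A) s (∑ j, c j s • b j)) volume 0 T := fun c hc =>
      ((continuous_flow (-A)).clm_apply (continuous_finsetSum _ fun j _ =>
        (hc j).continuous.smul continuous_const)).intervalIntegrable _ _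
    rw [← intervalIntegral.integral_add (hi c hc) (hi d hd)]
    simp only [← map_add, ← Finset.sum_add_distrib, add_smul]
  smul_mem' := by
    rintro a _ ⟨c, hc, rfl⟩
    refine ⟨fun j s => a * c j s, fun j => contDiff_const.mul (hc j), ?_⟩
    rw [← intervalIntegral.integral_smul]
    simp only [← map_smul, Finset.smul_sum, mul_smul]

/-- Under the Kalman condition smooth controls reach every state: testing a functional that
vanishes on the reachable space with its own observation shows that the observation is zero. -/
theorem reachable_eq_top (A : Z →L[ℝ] Z) (b : ι → Z)
    (hK : ∀ f : Z →L[ℝ] ℝ, (∀ j k, f ((A ^ k) (b j)) = 0) → f = 0) {T : ℝ} (hT : 0 < T) :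
    reachable A b T = ⊤ := by
  classical
  have : CompleteSpace Z := FiniteDimensional.complete ℝ Z
  by_contra hne
  obtain ⟨f₀, hf₀, hle⟩ := Submodule.exists_le_ker_of_lt_top _ (lt_top_iff_ne_top.2 hne)
  set f : Z →L[ℝ] ℝ := LinearMap.toContinuousLinearMap f₀ with hf
  have hobs : ∀ j, ∀ t ∈ Ioo 0 T, f (flow (-A) t (b j)) = 0 := by
    intro j t ht
    set g : ℝ → ℝ := fun s => f (flow (-A) s (b j)) with hg
    have hgs : ContDiff ℝ ∞ g := f.contDiff.comp (contDiff_flow_apply (-A) (b j))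
    have hmem : (∫ s in (0 : ℝ)..T, flow (-A) s (g s • b j)) ∈ reachable A b T := by
      refine ⟨fun i s => if i = j then g s else 0, fun i => ?_, ?_⟩
      · by_cases h : i = j
        · simpa [h] using hgs
        · simpa [h] using contDiff_const
      · simp [ite_smul]
    have h0 : f (∫ s in (0 : ℝ)..T, flow (-A) s (g s • b j)) = 0 := hle hmem
    rw [← f.intervalIntegral_comp_comm] at h0
    · have h1 : (∫ s in (0 : ℝ)..T, g s * g s) = 0 := by
        simpa only [map_smul, smul_eq_mul] using h0
      by_contra hcon
      refine (intervalIntegral.integral_pos hT (hgs.continuous.mul hgs.continuous).continuousOn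
        (fun x _ => mul_self_nonneg _) ⟨t, Ioo_subset_Icc_self ht, ?_⟩).ne' h1
      exact mul_self_pos.2 hcon
    · exact ((continuous_flow (-A)).clm_apply
        (hgs.continuous.smul continuous_const)).intervalIntegrable _ _
  -- The observation may be differentiated at any interior time, and the flow is invertible.
  have hmid : T / 2 ∈ Ioo 0 T := ⟨by linarith, by linarith⟩
  have hz := hK (f.comp (flow (-A) (T / 2))) fun j k =>
    apply_flow_pow_eq_zero A f (b j) (hobs j) k _ hmid
  refine hf₀ (LinearMap.ext fun v => ?_)
  have := DFunLike.congr_fun hz (flow A (T / 2) v)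
  simpa [flow_neg_flow, hf] using this

/-- Kalman's theorem: null controllability with smooth controls in any positive time. -/
theorem exists_null_control (A : Z →L[ℝ] Z) (b : ι → Z)
    (hK : ∀ f : Z →L[ℝ] ℝ, (∀ j k, f ((A ^ k) (b j)) = 0) → f = 0) {T : ℝ} (hT : 0 < T) (z₀ : Z) :
    ∃ c : ι → ℝ → ℝ, (∀ j, ContDiff ℝ ∞ (c j)) ∧ ∃ z : ℝ → Z, ContDiff ℝ ∞ z ∧ z 0 = z₀ ∧
      z T = 0 ∧ ∀ t, HasDerivAt z (A (z t) + ∑ j, c j t • b j) t := by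
  have : CompleteSpace Z := FiniteDimensional.complete ℝ Z
  obtain ⟨c, hc, hcT⟩ : -z₀ ∈ reachable A b T := by
    rw [reachable_eq_top A b hK hT]; trivial
  set h : ℝ → Z := fun t => ∑ j, c j t • b j with hh
  have hhs : ContDiff ℝ ∞ h := ContDiff.sum fun j _ => (hc j).smul contDiff_const
  have hcont : Continuous fun s => flow (-A) s (h s) :=
    (continuous_flow (-A)).clm_apply hhs.continuous
  set z : ℝ → Z := fun t => flow A t (z₀ + ∫ s in (0 : ℝ)..t, flow (-A) s (h s)) with hz
  have hder : ∀ t, HasDerivAt z (A (z t) + h t) t := by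
    intro t
    have h1 := ((hcont.integral_hasStrictDerivAt 0 t).hasDerivAt).const_add z₀
    have h2 := (hasDerivAt_flow' A t).clm_apply h1
    rw [flow_flow_neg] at h2
    exact h2
  refine ⟨c, hc, z, contDiff_of_linear_ode A hhs hder, ?_, ?_, hder⟩
  · simp [hz, flow]
  · simp only [hz, hh, hcT, add_neg_cancel, map_zero]

end Control

/-! ### Uniqueness of solutions -/

/-- An absolutely continuous function whose derivative is almost everywhere a continuous function
is differentiable everywhere. -/
theorem hasDerivWithinAt_of_ae {V g : ℝ → ℝ} {T : ℝ} (hT : 0 < T)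
    (hV : AbsolutelyContinuousOnInterval V 0 T) (hg : Continuous g)
    (h : ∀ᵐ t ∂(volume.restrict (Ioo 0 T)), HasDerivAt V (g t) t) :
    ∀ t ∈ Icc 0 T, HasDerivWithinAt V (g t) (Icc 0 T) t := by
  have hint : ∀ t, HasDerivAt (fun t => ∫ s in (0 : ℝ)..t, g s) (g t) t := fun t =>
    (hg.integral_hasStrictDerivAt 0 t).hasDerivAt
  have hac := hV.sub ((hg.intervalIntegrable 0 T).absolutelyContinuousOnInterval_intervalIntegral
    (c := 0) left_mem_uIcc)
  have hae : ∀ᵐ t, t ∈ uIcc 0 T →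
      HasDerivAt (V - fun t => ∫ s in (0 : ℝ)..t, g s) 0 t := by
    rw [uIcc_of_le hT.le, ← ae_restrict_iff' measurableSet_Icc,
      ← Measure.restrict_congr_set Ioo_ae_eq_Icc]
    filter_upwards [h] with t ht
    simpa using ht.sub (hint t)
  obtain ⟨c, hc⟩ := hac.const_of_ae_hasDerivAt_zero hae
  rw [uIcc_of_le hT.le] at hc
  intro t ht
  refine (((hint t).add_const c).hasDerivWithinAt).congr_of_mem (fun s hs => ?_) ht
  have := hc s hs
  simp only [Pi.sub_apply] at this
  linarith

/-- The collocation operator as a continuous linear map. -/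
def collocationCLM (N : ℕ) : (interiorNodes N → ℝ) →L[ℝ] (interiorNodes N → ℝ) :=
  LinearMap.toContinuousLinearMap (collocation N)

/-- The generator `(y, v) ↦ (v, y'')` of the collocation wave equation as a first order system. -/
def generator (N : ℕ) : (interiorNodes N → ℝ) × (interiorNodes N → ℝ) →L[ℝ]
    (interiorNodes N → ℝ) × (interiorNodes N → ℝ) :=
  (ContinuousLinearMap.snd ℝ _ _).prod
    ((collocationCLM N).comp (ContinuousLinearMap.fst ℝ _ _))

theorem generator_apply (N : ℕ) (z : (interiorNodes N → ℝ) × (interiorNodes N → ℝ)) :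
    generator N z = (z.2, collocation N z.1) := rfl

theorem eq_interp_of_eval {N : ℕ} (hN : 1 ≤ N) {p : ℝ[X]} (hp : p.natDegree ≤ N)
    (h1 : p.eval 1 = 0) (h2 : p.eval (-1) = 0) :
    p = interp N fun x => p.eval x.1 := by
  refine eq_of_eval_nodes hN hp (natDegree_interp hN _) fun x hx => ?_
  rcases (mem_nodes_iff hN).1 hx with rfl | rfl | hx
  · rw [eval_interp_end hN _ (Or.inr rfl), h2]
  · rw [eval_interp_end hN _ (Or.inl rfl), h1]
  · rw [eval_interp _ ⟨x, hx⟩]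

theorem IsSolution.hasDerivWithinAt {N : ℕ} {T : ℝ} {u0 u1 : ℝ[X]} {f gL gR : ℝ → ℝ}
    {u : ℝ → ℝ[X]} (hu : IsSolution N T u0 u1 f gL gR u) {x : ℝ} (hx : x ∈ interiorNodes N)
    {t : ℝ} (ht : t ∈ Icc 0 T) :
    HasDerivWithinAt (fun s => (u s).eval x) (velocity T u x t) (Icc 0 T) t :=
  ((hu.contDiffOn x hx).differentiableOn one_ne_zero t ht).hasDerivWithinAt

/-- Two solutions with the same data agree at the interior nodes: the difference solves the
homogeneous system almost everywhere, hence everywhere, with zero initial data. -/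
theorem IsSolution.unique {N : ℕ} (hN : 1 ≤ N) {T : ℝ} (hT : 0 < T) {u0 u1 : ℝ[X]}
    {f gL gR : ℝ → ℝ} {u w : ℝ → ℝ[X]} (hu : IsSolution N T u0 u1 f gL gR u)
    (hw : IsSolution N T u0 u1 f gL gR w) {x : ℝ} (hx : x ∈ interiorNodes N) {t : ℝ}
    (ht : t ∈ Icc 0 T) :
    (u t).eval x = (w t).eval x ∧ velocity T u x t = velocity T w x t := by
  set Y : ℝ → interiorNodes N → ℝ := fun t x => (u t - w t).eval x.1 with hY
  set V : ℝ → interiorNodes N → ℝ := fun t x => velocity T u x t - velocity T w x t with hV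
  have hYd : ∀ t ∈ Icc 0 T, HasDerivWithinAt Y (V t) (Icc 0 T) t := fun t ht =>
    hasDerivWithinAt_pi.2 fun x => by
      simp only [hY, eval_sub]
      exact (hu.hasDerivWithinAt x.2 ht).sub (hw.hasDerivWithinAt x.2 ht)
  have hYc : ContinuousOn Y (Icc 0 T) := fun t ht => (hYd t ht).continuousWithinAt
  -- The right-hand side is extended to a continuous function on the whole line.
  have hgc : ∀ x : interiorNodes N,
      Continuous fun t => collocation N (IccExtend hT.le ((Icc 0 T).domRestrict Y) t) x := by
    intro x
    exact (continuous_apply x).comp ((collocationCLM N).continuous.comp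
      (continuousOn_iff_continuous_domRestrict.1 hYc).Icc_extend')
  have hgY : ∀ t ∈ Icc 0 T, IccExtend hT.le ((Icc 0 T).domRestrict Y) t = Y t := fun t ht =>
    IccExtend_of_mem hT.le _ ht
  have hVd : ∀ t ∈ Icc 0 T, HasDerivWithinAt V (collocation N (Y t)) (Icc 0 T) t := by
    intro t ht
    refine hasDerivWithinAt_pi.2 fun x => ?_
    rw [← hgY t ht]
    refine hasDerivWithinAt_of_ae (V := fun t => V t x) hT
      ((hu.absolutelyContinuous x x.2).sub (hw.absolutelyContinuous x x.2)) (hgc x) ?_ t ht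
    filter_upwards [hu.wave x x.2, hw.wave x x.2, hu.boundary_left, hu.boundary_right,
      hw.boundary_left, hw.boundary_right, ae_restrict_mem measurableSet_Ioo]
      with s h1 h2 h3 h4 h5 h6 hs
    have hs' := Ioo_subset_Icc_self hs
    rw [hgY s hs', collocation_apply, ← eq_interp_of_eval hN]
    · refine (h1.sub h2).congr_deriv ?_
      simp only [derivative_sub, eval_sub]
      ring
    · exact natDegree_le_of_degree_le (mem_degreeLE.1
        (Submodule.sub_mem _ (hu.degree_le s hs') (hw.degree_le s hs')))
    · rw [eval_sub, h4, h6, sub_self]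
    · rw [eval_sub, h3, h5, sub_self]
  have hZd : ∀ t ∈ Icc 0 T,
      HasDerivWithinAt (fun t => (Y t, V t)) (generator N (Y t, V t)) (Icc 0 T) t :=
    fun t ht => (hYd t ht).prodMk (hVd t ht)
  have h0 : (Y 0, V 0) = 0 := by
    refine Prod.ext (funext fun x => ?_) (funext fun x => ?_)
    · simp [hY, hu.initial_position x x.2, hw.initial_position x x.2]
    · simp [hV, hu.initial_velocity x x.2, hw.initial_velocity x x.2]
  have hunique := ODE_solution_unique_of_mem_Icc_right (v := fun _ => generator N)
    (s := fun _ => univ) (f := fun t => (Y t, V t)) (g := fun _ => 0) (a := 0) (b := T)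
    (fun _ _ => (generator N).lipschitz.lipschitzOnWith)
    (fun t ht => (hZd t ht).continuousWithinAt)
    (fun t ht => (hZd t (Ico_subset_Icc_self ht)).mono_of_mem_nhdsWithin
      (Icc_mem_nhdsGE_of_mem ht))
    (fun _ _ => mem_univ _) continuousOn_const
    (fun _ _ => by rw [map_zero]; exact hasDerivWithinAt_const _ _ _)
    (fun _ _ => mem_univ _) h0 ht
  have h1 := congrFun (congrArg Prod.fst hunique) ⟨x, hx⟩
  have h2 := congrFun (congrArg Prod.snd hunique) ⟨x, hx⟩
  constructor
  · simpa [hY, sub_eq_zero] using h1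
  · simpa [hV, sub_eq_zero] using h2

/-! ### Controlled solutions -/

/-- The control vectors of the first order system: the lift `Ψ_N''` of the Dirichlet control at
`1`, and the two profiles. -/
def controlVector (N : ℕ) : Fin 3 → (interiorNodes N → ℝ) × (interiorNodes N → ℝ) :=
  ![(0, fun x => (derivative (derivative (cardinal N 1))).eval x.1),
    (0, fun x => (profileL N).eval x.1), (0, fun x => (profileR N).eval x.1)]

theorem generator_pow (N k : ℕ) (y : interiorNodes N → ℝ) :
    (generator N ^ (2 * k)) (0, y) = (0, (collocation N)^[k] y) ∧
      (generator N ^ (2 * k + 1)) (0, y) = ((collocation N)^[k] y, 0) := by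
  have hodd : ∀ k, (generator N ^ (2 * k)) (0, y) = (0, (collocation N)^[k] y) →
      (generator N ^ (2 * k + 1)) (0, y) = ((collocation N)^[k] y, 0) := by
    intro k h
    rw [pow_succ']
    change generator N ((generator N ^ (2 * k)) (0, y)) = _
    rw [h, generator_apply, map_zero]
  have heven : (generator N ^ (2 * k)) (0, y) = (0, (collocation N)^[k] y) := by
    induction k with
    | zero => rfl
    | succ k ih =>
      rw [show 2 * (k + 1) = (2 * k + 1) + 1 by ring, pow_succ']
      change generator N ((generator N ^ (2 * k + 1)) (0, y)) = _
      rw [hodd k ih, generator_apply, Function.iterate_succ_apply']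
  exact ⟨heven, hodd k heven⟩

/-- The Kalman condition, from the observability of the collocation operator in each component. -/
theorem kalman {N : ℕ} (hN : 1 ≤ N)
    (f : (interiorNodes N → ℝ) × (interiorNodes N → ℝ) →L[ℝ] ℝ)
    (hf : ∀ j k, f ((generator N ^ k) (controlVector N j)) = 0) : f = 0 := by
  have hodd : (f : (interiorNodes N → ℝ) × (interiorNodes N → ℝ) →ₗ[ℝ] ℝ) ∘ₗ
      LinearMap.inl ℝ _ _ = 0 := by
    refine collocation_observable hN _ (fun k => ?_) (fun k => ?_)
    · have := hf 1 (2 * k + 1)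
      rwa [show controlVector N 1 = (0, _) from rfl, (generator_pow N k _).2] at this
    · have := hf 2 (2 * k + 1)
      rwa [show controlVector N 2 = (0, _) from rfl, (generator_pow N k _).2] at this
  have heven : (f : (interiorNodes N → ℝ) × (interiorNodes N → ℝ) →ₗ[ℝ] ℝ) ∘ₗ
      LinearMap.inr ℝ _ _ = 0 := by
    refine collocation_observable hN _ (fun k => ?_) (fun k => ?_)
    · have := hf 1 (2 * k)
      rwa [show controlVector N 1 = (0, _) from rfl, (generator_pow N k _).1] at this
    · have := hf 2 (2 * k)
      rwa [show controlVector N 2 = (0, _) from rfl, (generator_pow N k _).1] at this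
  ext1
  · exact ContinuousLinearMap.ext fun y => DFunLike.congr_fun hodd y
  · exact ContinuousLinearMap.ext fun y => DFunLike.congr_fun heven y

/-- A trajectory of the controlled first order system, completed by the boundary value `c 0` at
`1`, solves the collocation system. -/
theorem isSolution_of_trajectory {N : ℕ} (hN : 1 ≤ N) {T : ℝ} (hT : 0 < T) {u0 u1 : ℝ[X]}
    {c : Fin 3 → ℝ → ℝ} {z : ℝ → (interiorNodes N → ℝ) × (interiorNodes N → ℝ)}
    (hz : ContDiff ℝ ∞ z)
    (hz0 : z 0 = (fun x => u0.eval x.1, fun x => u1.eval x.1))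
    (hode : ∀ t, HasDerivAt z (generator N (z t) + ∑ j, c j t • controlVector N j) t) :
    IsSolution N T u0 u1 (c 0) (c 1) (c 2)
        (fun t => interp N (z t).1 + C (c 0 t) * cardinal N 1) ∧
      ∀ t ∈ Icc 0 T, ∀ x (hx : x ∈ interiorNodes N),
        velocity T (fun t => interp N (z t).1 + C (c 0 t) * cardinal N 1) x t
          = (z t).2 ⟨x, hx⟩ := by
  set u : ℝ → ℝ[X] := fun t => interp N (z t).1 + C (c 0 t) * cardinal N 1 with hu
  have h1 := one_mem_nodes hN
  have heval : ∀ x (hx : x ∈ interiorNodes N), (fun t => (u t).eval x) = fun t =>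
      (z t).1 ⟨x, hx⟩ := by
    intro x hx
    funext t
    have := ne_of_mem_interiorNodes hx
    simp only [hu, eval_add, eval_mul, eval_C]
    rw [eval_interp _ ⟨x, hx⟩, eval_cardinal_of_ne (interiorNodes_subset N hx) this.2.symm]
    simp
  have hd : ∀ t, HasDerivAt (fun t => (z t).1) (z t).2 t ∧ HasDerivAt (fun t => (z t).2)
      (collocation N (z t).1 + ∑ j, c j t • (controlVector N j).2) t := by
    intro t
    have ha : HasDerivAt (fun t => (z t).1) _ t :=
      (ContinuousLinearMap.fst ℝ (interiorNodes N → ℝ) (interiorNodes N → ℝ)).hasFDerivAt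
        |>.comp_hasDerivAt t (hode t)
    have hb : HasDerivAt (fun t => (z t).2) _ t :=
      (ContinuousLinearMap.snd ℝ (interiorNodes N → ℝ) (interiorNodes N → ℝ)).hasFDerivAt
        |>.comp_hasDerivAt t (hode t)
    refine ⟨ha.congr_deriv ?_, hb.congr_deriv ?_⟩
    · simp [generator_apply, Fin.sum_univ_three, controlVector]
    · simp [generator_apply, Fin.sum_univ_three]
  have hvel : ∀ t ∈ Icc 0 T, ∀ x (hx : x ∈ interiorNodes N),
      velocity T u x t = (z t).2 ⟨x, hx⟩ := by
    intro t ht x hx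
    rw [velocity, heval x hx]
    exact (hasDerivAt_pi.1 (hd t).1 ⟨x, hx⟩).hasDerivWithinAt.derivWithin
      (uniqueDiffOn_Icc hT t ht)
  have h0 : (0 : ℝ) ∈ Icc 0 T := ⟨le_rfl, hT.le⟩
  refine ⟨⟨fun t _ => ?_, fun x hx => ?_, fun x hx => ?_, fun x hx => ?_, ?_, ?_, fun x hx => ?_,
    fun x hx => ?_⟩, hvel⟩
  · refine mem_degreeLE.2 (degree_le_of_natDegree_le ?_)
    exact natDegree_add_le_of_degree_le (natDegree_interp hN _)
      ((natDegree_C_mul_le _ _).trans (natDegree_cardinal hN h1))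
  · rw [heval x hx]
    exact (((contDiff_apply ℝ ℝ _).comp hz.fst).of_le (by exact_mod_cast le_top)).contDiffOn
  · refine ContDiffOn.absolutelyContinuousOnInterval ?_
    rw [uIcc_of_le hT.le]
    refine ContDiffOn.congr (f := fun t => (z t).2 ⟨x, hx⟩) ?_ fun t ht => hvel t ht x hx
    exact (((contDiff_apply ℝ ℝ _).comp hz.snd).of_le (by exact_mod_cast le_top)).contDiffOn
  · filter_upwards [ae_restrict_mem measurableSet_Ioo] with t ht
    have hder := hasDerivAt_pi.1 (hd t).2 ⟨x, hx⟩
    refine (hder.congr_of_eventuallyEq ?_).congr_deriv ?_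
    · filter_upwards [isOpen_Ioo.mem_nhds ht] with s hs
      exact hvel s (Ioo_subset_Icc_self hs) x hx
    · simp [hu, Fin.sum_univ_three, controlVector, collocation_apply]
      ring
  · refine Filter.Eventually.of_forall fun t => ?_
    simp only [hu, eval_add, eval_mul, eval_C]
    rw [eval_interp_end hN _ (Or.inl rfl), eval_cardinal_self h1]
    ring
  · refine Filter.Eventually.of_forall fun t => ?_
    simp only [hu, eval_add, eval_mul, eval_C]
    rw [eval_interp_end hN _ (Or.inr rfl),
      eval_cardinal_of_ne (neg_one_mem_nodes hN) (by norm_num)]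
    ring
  · rw [congrFun (heval x hx) 0, hz0]
  · rw [hvel 0 h0 x hx, hz0]

theorem contDiff_coeff {N : ℕ} {f : ℝ → ℝ} (hf : ContDiff ℝ ∞ f) {y : ℝ → interiorNodes N → ℝ}
    (hy : ContDiff ℝ ∞ y) (k : ℕ) :
    ContDiff ℝ ∞ fun t => (interp N (y t) + C (f t) * cardinal N 1).coeff k := by
  simp only [interp_apply, coeff_add, finsetSum_coeff, coeff_C_mul]
  exact (ContDiff.sum fun x _ => ((contDiff_apply ℝ ℝ x).comp hy).mul contDiff_const).add
    (hf.mul contDiff_const)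

theorem memLp_of_continuous {f : ℝ → ℝ} (hf : Continuous f) (T : ℝ) :
    MemLp f 2 (volume.restrict (Ioo 0 T)) := by
  obtain ⟨M, hM⟩ := (isCompact_Icc (a := 0) (b := T)).exists_bound_of_continuousOn
    hf.continuousOn
  refine MemLp.of_bound hf.aestronglyMeasurable M ?_
  filter_upwards [ae_restrict_mem measurableSet_Ioo] with t ht
  exact hM t (Ioo_subset_Icc_self ht)

end LGL

end

theorem theorem1 (N : ℕ) (hN : 1 ≤ N) (T : ℝ) (hT : 4 * (2 + 1 / (N : ℝ)) < T)
    (u0 u1 : ℝ[X]) (hu0 : u0 ∈ LGL.polyDirichlet N) (hu1 : u1 ∈ LGL.polyDirichlet N) :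
    ∃ f gL gR : ℝ → ℝ,
      MemLp f 2 (volume.restrict (Ioo 0 T)) ∧
      MemLp gL 2 (volume.restrict (Ioo 0 T)) ∧
      MemLp gR 2 (volume.restrict (Ioo 0 T)) ∧
      (∃ u : ℝ → ℝ[X], LGL.IsSolution N T u0 u1 f gL gR u ∧
        ∀ k : ℕ, ContDiffOn ℝ ∞ (fun t => (u t).coeff k) (Icc 0 T)) ∧
      ∀ u : ℝ → ℝ[X], LGL.IsSolution N T u0 u1 f gL gR u →
        ∀ x ∈ LGL.interiorNodes N, (u T).eval x = 0 ∧ LGL.velocity T u x T = 0 := by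
  have hT0 : 0 < T := lt_trans (by positivity) hT
  obtain ⟨c, hc, z, hz, hz0, hzT, hode⟩ := LGL.exists_null_control (LGL.generator N)
    (LGL.controlVector N) (LGL.kalman hN) hT0 (fun x => u0.eval x.1, fun x => u1.eval x.1)
  obtain ⟨hsol, hvel⟩ := LGL.isSolution_of_trajectory hN hT0 hz hz0 hode
  refine ⟨c 0, c 1, c 2, LGL.memLp_of_continuous (hc 0).continuous T,
    LGL.memLp_of_continuous (hc 1).continuous T, LGL.memLp_of_continuous (hc 2).continuous T,
    ⟨_, hsol, fun k => (LGL.contDiff_coeff (hc 0) hz.fst k).contDiffOn⟩, fun u hu x hx => ?_⟩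
  have hTT : T ∈ Icc 0 T := ⟨hT0.le, le_rfl⟩
  obtain ⟨h1, h2⟩ := hu.unique hN hT0 hsol hx hTT
  rw [h1, h2, hvel T hTT x hx, hzT]
  have hne := LGL.ne_of_mem_interiorNodes hx
  simp only [eval_add, eval_mul, eval_C, LGL.eval_interp _ ⟨x, hx⟩,
    LGL.eval_cardinal_of_ne (LGL.interiorNodes_subset N hx) hne.2.symm]
  simp
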